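/- Definitions. A range set is a set $R\subseteq[0,\infty)$ with $0\in R$. An ultrametric space $(X,d)$ is $R$-valued if $d(x,y)\in R$ for all $x,y\in X$. A metric space $X$ is injective for the finite $R$-valued ultrametric spaces if it is nonempty and, for all finite $R$-valued ultrametric spaces $Y,Z$ and all isometric embeddings $\phi\colon Y\to Z$ and $f\colon Y\to X$, there is an isometric embedding $F\colon Z\to X$ with $F\circ\phi=f$. A range set $S$ is tenuous if it is finite or of the form $\{0\}\cup\{a_i\mid i\ge 0\}$ for a strictly decreasing sequence $(a_i)$ of positive reals with limit $0$. If $R$ is finite or countable, the $R$-Urysohn universal ultrametric space is the (unique up to isometry) separable complete $R$-valued ultrametric space that is injective for the finite $R$-valued ultrametric spaces. If $R$ is uncountable, it is the (unique up to isometry) $R$-petaloid space, i.e. the $R$-valued ultrametric space $(X,d)$ for which there is a family $(\Pi_S)$ of nonempty subspaces of $X$, indexed by the tenuous range sets $S\subseteq R$, such that 1. for every $S\ne\{0\}$, $\Pi_S$ is the $S$-Urysohn universal ultrametric space; 2. $\bigcup_S\Pi_S=X$; 3. $\Pi_S\cap\Pi_T=\Pi_{S\cap T}$ for all $S,T$;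 4. $d(x,\Pi_S)=\inf_{y\in \Pi_S}d(x,y)\in\{0\}\cup(T\setminus S)$ for all $S,T$ and all $x\in\Pi_T$. Theorem. Let $m\in\mathbb{Z}_{\ge 2}\cup\{\infty\}$, let $R$ be a range set, let $l\in(0,\infty]$, and let $(X,d)$ be the $R$-Urysohn universal ultrametric space. Let $\mathcal{K}_{m,l}(X)$ be the set of all nonempty compact subsets $E$ of $X$ with at most $m$ points and with diameter at most $l$ (where $m=\infty$, respectively $l=\infty$, means no restriction), equipped with the Hausdorff metric $$d_H(E,F)=\max\Big\{\sup_{a\in E}d(a,F),\ \sup_{b\in F}d(b,E)\Big\}.$$ Then $(\mathcal{K}_{m,l}(X),d_H)$ is the $R$-Urysohn universal ultrametric space. In particular, it is isometric to $(X,d)$. (The case $m=l=\infty$ is the space $\mathcal{K}(X)$ of all nonempty compact subsets; the case $l=\infty$, $m<\infty$ is the $m$-th symmetric product.) -/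

import Mathlib

open Set Filter Topology TopologicalSpace
open scoped ENNReal

/-- A range set: a subset of `[0, ∞)` that contains `0`. -/
def IsRangeSet (R : Set ℝ) : Prop :=
  R ⊆ Ici 0 ∧ (0 : ℝ) ∈ R

/-- `X` is an ultrametric space all of whose distances lie in `R`. -/
structure IsValuedUltrametric (R : Set ℝ) (X : Type*) [MetricSpace X] : Prop where
  ultra : IsUltrametricDist X
  dist_mem : ∀ x y : X, dist x y ∈ R

/-- Injectivity for the class of all finite `R`-valued ultrametric spaces: `X` is nonempty, and
for all finite `R`-valued ultrametric spaces `Y` and `Z` (possibly empty) and isometric embeddings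
`φ : Y → Z` and `f : Y → X`, there is an isometric embedding `F : Z → X` with `F ∘ φ = f`. -/
def IsFiniteUltrametricInjective (R : Set ℝ) (X : Type*) [MetricSpace X] : Prop :=
  Nonempty X ∧
    ∀ (Y Z : Type) [MetricSpace Y] [MetricSpace Z] [Finite Y] [Finite Z],
      IsValuedUltrametric R Y → IsValuedUltrametric R Z →
      ∀ (φ : Y → Z) (f : Y → X), Isometry φ → Isometry f →
        ∃ F : Z → X, Isometry F ∧ F ∘ φ = f

/-- `X` is a separable complete `R`-valued ultrametric space that is injective for the finite
`R`-valued ultrametric spaces. For a finite or countable range set `R`, this is what it means to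
be the `R`-Urysohn universal ultrametric space. -/
structure IsSeparableUrysohnUltrametric (R : Set ℝ) (X : Type*) [MetricSpace X] : Prop where
  separable : SeparableSpace X
  complete : CompleteSpace X
  injective : IsFiniteUltrametricInjective R X
  valued : IsValuedUltrametric R X

/-- `E = {0} ∪ {a i | i}` for a strictly decreasing sequence `a` of positive reals with limit
zero. -/
def IsSemiSporadic (E : Set ℝ) : Prop :=
  ∃ a : ℕ → ℝ, StrictAnti a ∧ (∀ i, 0 < a i) ∧ Tendsto a atTop (𝓝 0) ∧ E = {0} ∪ range a

/-- A set is tenuous if it is finite or semi-sporadic. -/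
def IsTenuous (E : Set ℝ) : Prop :=
  E.Finite ∨ IsSemiSporadic E

/-- The family of all tenuous range sets contained in `R`. -/
def tenuousRangeSubsets (R : Set ℝ) : Set (Set ℝ) :=
  {S | IsRangeSet S ∧ IsTenuous S ∧ S ⊆ R}

/-- The family `P` of (nonempty) subspaces of `X`, of which only the members with index a tenuous
range subset of `R` matter, is an `R`-petal of `X`. Nonemptiness is recorded since
`Metric.infDist x ∅ = 0` in Mathlib, whereas the distance to the empty set is an infimum over
the empty set; it only adds something for `S = {0}`. -/
structure IsPetal (R : Set ℝ) (X : Type*) [MetricSpace X] (P : Set ℝ → Set X) : Prop where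
  nonempty : ∀ S ∈ tenuousRangeSubsets R, (P S).Nonempty
  urysohn : ∀ S ∈ tenuousRangeSubsets R, S ≠ {0} → IsSeparableUrysohnUltrametric S (P S)
  iUnion_eq : ⋃ S ∈ tenuousRangeSubsets R, P S = univ
  inter_eq : ∀ S ∈ tenuousRangeSubsets R, ∀ T ∈ tenuousRangeSubsets R,
    P S ∩ P T = P (S ∩ T)
  infDist_mem : ∀ S ∈ tenuousRangeSubsets R, ∀ T ∈ tenuousRangeSubsets R, ∀ x ∈ P T,
    Metric.infDist x (P S) ∈ ({0} ∪ (T \ S) : Set ℝ)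

/-- `X` is an `R`-petaloid ultrametric space (a notion used for uncountable `R`). -/
structure IsPetaloid (R : Set ℝ) (X : Type*) [MetricSpace X] : Prop where
  valued : IsValuedUltrametric R X
  exists_petal : ∃ P : Set ℝ → Set X, IsPetal R X P

/-- `X` is the `R`-Urysohn universal ultrametric space: for `R` finite or countable it is the
separable complete injective one, for `R` uncountable it is the petaloid one. -/
def IsUrysohnUniversalUltrametric (R : Set ℝ) (X : Type*) [MetricSpace X] : Prop :=
  (R.Countable → IsSeparableUrysohnUltrametric R X) ∧ (¬ R.Countable → IsPetaloid R X)

/-- The space of nonempty compact subsets of `X` with at most `m` points and diameter at most `l`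
(no restriction for the value `⊤`). Its metric is the restriction of the metric of
`NonemptyCompacts X`, which is the Hausdorff distance. -/
abbrev BoundedHyperspace (X : Type*) [MetricSpace X] (m : ℕ∞) (l : ℝ≥0∞) : Type _ :=
  {E : NonemptyCompacts X // (E : Set X).encard ≤ m ∧ Metric.ediam (E : Set X) ≤ l}

/-!
Choose in every closed ball of radius `r ∈ R`, `r > 0`, one of its open balls of radius `r`, label
it `0`, and label the others by the positive integers. If the choices are made coherently, then
every point has only finitely many nonzero labels above each positive bound, all such label
functions occur, and the distance of two points is the largest `r` at which their labels differ.
Hence the `R`-Urysohn universal ultrametric space is unique, for countable and uncountable `R`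
alike.

For complete `R`-valued ultrametric spaces, injectivity is the same as the one-point extension
property that finitely many points with mutual distances at most `r ∈ R` have a common point at
distance exactly `r`. Compact sets inherit this property: given finitely many of them, collapse in
one of them the part in a ball of radius `r` to a point that is at distance at least `r` from all
of them. For uncountable `R`, every compact set lies in a single member of the petal, so that the
compact subsets of the members of a petal of `X` form a petal of the hyperspace.
-/

/-- A set of reals that has only finitely many elements above every positive bound. -/
def IsFiniteAwayFromZero (S : Set ℝ) : Prop :=
  ∀ δ > 0, (S ∩ Ici δ).Finite

namespace IsFiniteAwayFromZero

variable {S T : Set ℝ}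

theorem of_finite (hS : S.Finite) : IsFiniteAwayFromZero S :=
  fun _ _ => hS.subset inter_subset_left

theorem mono (hT : IsFiniteAwayFromZero T) (h : S ⊆ T) : IsFiniteAwayFromZero S :=
  fun δ hδ => (hT δ hδ).subset (inter_subset_inter_left _ h)

theorem union (hS : IsFiniteAwayFromZero S) (hT : IsFiniteAwayFromZero T) :
    IsFiniteAwayFromZero (S ∪ T) := fun δ hδ => by
  rw [union_inter_distrib_right]
  exact (hS δ hδ).union (hT δ hδ)

theorem biUnion {ι : Type*} {s : Set ι} (hs : s.Finite) {S : ι → Set ℝ}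
    (hS : ∀ i ∈ s, IsFiniteAwayFromZero (S i)) : IsFiniteAwayFromZero (⋃ i ∈ s, S i) :=
  fun δ hδ => by
    rw [iUnion₂_inter]
    exact hs.biUnion fun i hi => hS i hi δ hδ

theorem iUnion_inter_Iio {S : ℕ → Set ℝ} (hS : ∀ n, IsFiniteAwayFromZero (S n)) {ε : ℕ → ℝ}
    (hε : Tendsto ε atTop (𝓝 0)) : IsFiniteAwayFromZero (⋃ n, S n ∩ Iio (ε n)) := fun δ hδ => by
  obtain ⟨N, hN⟩ := eventually_atTop.1 (hε.eventually_lt_const hδ)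
  refine ((finite_Iio N).biUnion fun n _ => hS n δ hδ).subset ?_
  rintro s ⟨hs, hδs⟩
  obtain ⟨n, hsS, hsn⟩ := mem_iUnion.1 hs
  have hnN : n < N := not_le.1 fun h => (hδs.trans_lt hsn).not_gt (hN n h)
  exact mem_biUnion hnN ⟨hsS, hδs⟩

theorem exists_isGreatest (hS : IsFiniteAwayFromZero S) {b : ℝ} (hb : b ∈ S) (hb0 : 0 < b) :
    ∃ x, IsGreatest S x := by
  obtain ⟨x, ⟨hxS, hbx⟩, hmax⟩ :=
    (S ∩ Ici b).exists_max_image id (hS b hb0) ⟨b, hb, mem_Ici.2 le_rfl⟩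
  exact ⟨x, hxS, fun y hy => (le_total b y).elim (fun h => hmax y ⟨hy, h⟩) fun h => h.trans hbx⟩

theorem exists_mem_Ioo (hS : IsFiniteAwayFromZero S) (hinf : (S ∩ Ioi 0).Infinite) {δ : ℝ}
    (hδ : 0 < δ) : ∃ x ∈ S, x ∈ Ioo 0 δ := by
  obtain ⟨x, ⟨hxS, hx0⟩, hx⟩ := hinf.exists_notMem_finite (hS δ hδ)
  exact ⟨x, hxS, hx0, not_le.1 fun h => hx ⟨hxS, h⟩⟩

/-- Under the reversed order the positive part of `S` is locally finite with a least but no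
greatest element, hence order isomorphic to `ℕ`. -/
theorem exists_strictAnti_range_eq (hS : IsFiniteAwayFromZero S) (hinf : (S ∩ Ioi 0).Infinite) :
    ∃ a : ℕ → ℝ, StrictAnti a ∧ range a = S ∩ Ioi 0 := by
  let V := S ∩ Ioi 0
  obtain ⟨v, hvV⟩ := hinf.nonempty
  obtain ⟨g, hg⟩ := (hS.mono (inter_subset_left : V ⊆ S)).exists_isGreatest hvV hvV.2
  let : LocallyFiniteOrder Vᵒᵈ := LocallyFiniteOrder.ofFiniteIcc fun x y =>
    ((hS _ (OrderDual.ofDual y).2.2).preimage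
      (Subtype.val_injective.comp OrderDual.ofDual.injective).injOn).subset
      fun z hz => ⟨(OrderDual.ofDual z).2.1, hz.2⟩
  let : OrderBot Vᵒᵈ := { bot := OrderDual.toDual ⟨g, hg.1⟩, bot_le := fun x => hg.2 x.2 }
  have : NoMaxOrder Vᵒᵈ := ⟨fun x => by
    obtain ⟨y, hyS, hy0, hyx⟩ := hS.exists_mem_Ioo hinf (OrderDual.ofDual x).2.2
    exact ⟨OrderDual.toDual ⟨y, hyS, hy0⟩, hyx⟩⟩
  let := LinearLocallyFiniteOrder.succOrder Vᵒᵈ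
  let := LinearLocallyFiniteOrder.predOrder Vᵒᵈ
  let e : ℕ ≃o Vᵒᵈ := orderIsoNatOfLinearSuccPredArch.symm
  refine ⟨fun n => (OrderDual.ofDual (e n)).1, fun i j hij => e.strictMono hij, ?_⟩
  have he : range (OrderDual.ofDual ∘ e) = univ :=
    (OrderDual.ofDual.surjective.comp e.surjective).range_eq
  rw [show (fun n => (OrderDual.ofDual (e n)).1) = Subtype.val ∘ OrderDual.ofDual ∘ e from rfl,
    range_comp, he, image_univ, Subtype.range_coe]

theorem isTenuous (hS : IsFiniteAwayFromZero S) (hR : IsRangeSet S) : IsTenuous S := by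
  have hS_eq : S = {0} ∪ S ∩ Ioi 0 := by
    ext x
    constructor
    · intro hx
      exact (hR.1 hx).eq_or_lt.imp Eq.symm fun h => ⟨hx, h⟩
    · rintro (rfl | hx)
      exacts [hR.2, hx.1]
  by_cases hfin : (S ∩ Ioi 0).Finite
  · exact Or.inl (hS_eq ▸ (finite_singleton 0).union hfin)
  obtain ⟨a, ha, hrange⟩ := hS.exists_strictAnti_range_eq hfin
  have hpos : ∀ i, 0 < a i := fun i => (hrange.le (mem_range_self i)).2
  refine Or.inr ⟨a, ha, hpos, ?_, hrange.symm ▸ hS_eq⟩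
  refine tendsto_order.2 ⟨fun b hb => .of_forall fun i => hb.trans (hpos i), fun b hb => ?_⟩
  obtain ⟨x, hxS, hx0, hxb⟩ := hS.exists_mem_Ioo hfin hb
  obtain ⟨N, rfl⟩ := hrange.ge ⟨hxS, hx0⟩
  exact eventually_atTop.2 ⟨N, fun i hi => (ha.antitone hi).trans_lt hxb⟩

end IsFiniteAwayFromZero

theorem IsTenuous.isFiniteAwayFromZero {S : Set ℝ} (hS : IsTenuous S) :
    IsFiniteAwayFromZero S := by
  rcases hS with hS | ⟨a, -, -, ha, rfl⟩
  · exact .of_finite hS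
  refine (IsFiniteAwayFromZero.of_finite (finite_singleton 0)).union fun δ hδ => ?_
  obtain ⟨N, hN⟩ := eventually_atTop.1 (ha.eventually_lt_const hδ)
  refine ((finite_Iio N).image a).subset ?_
  rintro _ ⟨⟨i, rfl⟩, hi⟩
  exact ⟨i, not_le.1 fun h => (hN i h).not_ge hi, rfl⟩

section tenuousRangeSubsets

variable {R S T : Set ℝ}

theorem mem_tenuousRangeSubsets (hR : IsRangeSet R) :
    S ∈ tenuousRangeSubsets R ↔ 0 ∈ S ∧ IsFiniteAwayFromZero S ∧ S ⊆ R where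
  mp h := ⟨h.1.2, h.2.1.isFiniteAwayFromZero, h.2.2⟩
  mpr h :=
    have hS : IsRangeSet S := ⟨h.2.2.trans hR.1, h.1⟩
    ⟨hS, h.2.1.isTenuous hS, h.2.2⟩

theorem singleton_zero_mem_tenuousRangeSubsets (hR : IsRangeSet R) :
    {0} ∈ tenuousRangeSubsets R :=
  (mem_tenuousRangeSubsets hR).2 ⟨rfl, .of_finite (finite_singleton 0), singleton_subset_iff.2 hR.2⟩

theorem union_mem_tenuousRangeSubsets (hR : IsRangeSet R) (hS : S ∈ tenuousRangeSubsets R)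
    (hT : T ∈ tenuousRangeSubsets R) : S ∪ T ∈ tenuousRangeSubsets R := by
  rw [mem_tenuousRangeSubsets hR] at *
  exact ⟨Or.inl hS.1, hS.2.1.union hT.2.1, union_subset hS.2.2 hT.2.2⟩

theorem insert_mem_tenuousRangeSubsets (hR : IsRangeSet R) (hS : S ∈ tenuousRangeSubsets R)
    {r : ℝ} (hr : r ∈ R) : insert r S ∈ tenuousRangeSubsets R := by
  rw [mem_tenuousRangeSubsets hR] at *
  exact ⟨Or.inr hS.1, (IsFiniteAwayFromZero.of_finite (finite_singleton r)).union hS.2.1,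
    insert_subset hr hS.2.2⟩

theorem mem_tenuousRangeSubsets_of_subset (hR : IsRangeSet R) (hS : S ∈ tenuousRangeSubsets R)
    (hT : T ⊆ S) (hT0 : 0 ∈ T) : T ∈ tenuousRangeSubsets R := by
  rw [mem_tenuousRangeSubsets hR] at *
  exact ⟨hT0, hS.2.1.mono hT, hT.trans hS.2.2⟩

theorem exists_mem_tenuousRangeSubsets_superset (hR : IsRangeSet R) {U : ℕ → Set ℝ}
    (hU : ∀ n, IsFiniteAwayFromZero (U n)) (hUR : ∀ n, U n ⊆ R) {ε : ℕ → ℝ}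
    (hε : Tendsto ε atTop (𝓝 0)) :
    ∃ S ∈ tenuousRangeSubsets R, U 0 ⊆ S ∧ ∀ n, U (n + 1) ∩ Iio (ε n) ⊆ S := by
  refine ⟨{0} ∪ (U 0 ∪ ⋃ n, U (n + 1) ∩ Iio (ε n)),
    (mem_tenuousRangeSubsets hR).2 ⟨Or.inl rfl, ?_, ?_⟩,
    fun s hs => Or.inr (Or.inl hs), fun n s hs => Or.inr (Or.inr (mem_iUnion.2 ⟨n, hs⟩))⟩
  · exact (IsFiniteAwayFromZero.of_finite (finite_singleton 0)).union
      ((hU 0).union (.iUnion_inter_Iio (fun n => hU (n + 1)) hε))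
  · exact union_subset (singleton_subset_iff.2 hR.2) (union_subset (hUR 0)
      (iUnion_subset fun n => inter_subset_left.trans (hUR (n + 1))))

end tenuousRangeSubsets

theorem IsValuedUltrametric.of_isometry {R : Set ℝ} {X Y : Type*} [MetricSpace X] [MetricSpace Y]
    (hX : IsValuedUltrametric R X) {f : Y → X} (hf : Isometry f) : IsValuedUltrametric R Y where
  ultra := ⟨fun x y z => by
    simpa only [hf.dist_eq] using hX.ultra.dist_triangle_max (f x) (f y) (f z)⟩
  dist_mem x y := hf.dist_eq x y ▸ hX.dist_mem (f x) (f y)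

theorem dist_eq_of_dist_lt {X : Type*} [MetricSpace X] [IsUltrametricDist X] {x y z : X}
    (h : dist x y < dist y z) : dist x z = dist y z := by
  rw [IsUltrametricDist.dist_eq_max_of_dist_ne_dist x y z h.ne, max_eq_right h.le]

/-- Every finite set of diameter at most `r ∈ R`, `r > 0`, admits a point at distance exactly `r`
from all of its points. For `R`-valued ultrametric spaces this amounts to injectivity for the
finite `R`-valued ultrametric spaces, but it is much easier to verify. -/
def HasEquidistantExtension (R : Set ℝ) (X : Type*) [MetricSpace X] : Prop :=
  ∀ r ∈ R, 0 < r → ∀ A : Set X, A.Finite → (∀ x ∈ A, ∀ y ∈ A, dist x y ≤ r) →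
    ∃ p, ∀ x ∈ A, dist p x = r

/-- The metric on `Option Y` that extends the one of `Y` by a point `none` at distance `r` from
all points of `Y`. -/
abbrev adjoinPointMetric (Y : Type*) [MetricSpace Y] (r : ℝ) (hr : 0 < r)
    (h : ∀ x y : Y, dist x y ≤ r) : MetricSpace (Option Y) where
  dist
    | none, none => 0
    | none, some _ => r
    | some _, none => r
    | some x, some y => dist x y
  dist_self := by rintro (_ | x) <;> simp
  dist_comm := by rintro (_ | x) (_ | y) <;> simp [dist_comm]
  dist_triangle := by
    rintro (_ | x) (_ | y) (_ | z)
    case some.none.some => exact (h x z).trans (by linarith)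
    case some.some.some => exact dist_triangle x y z
    all_goals simp [hr.le]
  eq_of_dist_eq_zero := by rintro (_ | x) (_ | y) <;> simp [hr.ne']

theorem IsValuedUltrametric.adjoinPointMetric {R : Set ℝ} {Y : Type*} [MetricSpace Y]
    (hY : IsValuedUltrametric R Y) (h0 : 0 ∈ R) {r : ℝ} (hrR : r ∈ R) (hr : 0 < r)
    (h : ∀ x y : Y, dist x y ≤ r) :
    @IsValuedUltrametric R (Option Y) (adjoinPointMetric Y r hr h) := by
  let := _root_.adjoinPointMetric Y r hr h
  refine ⟨⟨?_⟩, ?_⟩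
  · rintro (_ | x) (_ | y) (_ | z)
    case none.some.none => exact le_max_of_le_left hr.le
    case some.none.some => exact le_max_of_le_left (h x z)
    case some.some.some => exact hY.ultra.dist_triangle_max x y z
    all_goals simp [dist]
  · rintro (_ | x) (_ | y)
    exacts [h0, hrR, hrR, hY.dist_mem x y]

theorem exists_isometry_range_eq {X : Type*} [MetricSpace X] {A : Set X} (hA : A.Finite) :
    ∃ (Y : Type) (_ : Finite Y) (_ : MetricSpace Y) (f : Y → X), Isometry f ∧ range f = A := by
  have := hA.to_subtype
  obtain ⟨n, ⟨e⟩⟩ := Finite.exists_equiv_fin A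
  have hf : Function.Injective (Subtype.val ∘ e.symm) :=
    Subtype.val_injective.comp e.symm.injective
  refine ⟨Fin n, inferInstance, .induced _ hf inferInstance, _, MetricSpace.isometry_induced _ hf,
    ?_⟩
  rw [range_comp, e.symm.range_eq_univ, image_univ, Subtype.range_coe]

theorem IsFiniteUltrametricInjective.hasEquidistantExtension {R : Set ℝ} {X : Type*}
    [MetricSpace X] (h0 : 0 ∈ R) (hX : IsFiniteUltrametricInjective R X)
    (hv : IsValuedUltrametric R X) : HasEquidistantExtension R X := by
  intro r hrR hr A hA hAr
  obtain ⟨Y, _, _, f, hf, rfl⟩ := exists_isometry_range_eq hA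
  have hYr : ∀ x y : Y, dist x y ≤ r := fun x y =>
    hf.dist_eq x y ▸ hAr _ (mem_range_self x) _ (mem_range_self y)
  have hY : IsValuedUltrametric R Y := hv.of_isometry hf
  have hZ := hY.adjoinPointMetric h0 hrR hr hYr
  let := adjoinPointMetric Y r hr hYr
  obtain ⟨F, hF, hFf⟩ := hX.2 Y (Option Y) hY hZ some f (Isometry.of_dist_eq fun _ _ => rfl) hf
  refine ⟨F none, forall_mem_range.2 fun y => ?_⟩
  rw [← hFf, Function.comp_apply, hF.dist_eq]
  rfl

section HasEquidistantExtension

variable {R : Set ℝ} {X Z : Type*} [MetricSpace X] [MetricSpace Z] [Nonempty X]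

/-- A point equidistant from the images of the points nearest to `z` has the correct distance to
all the other images as well, by the isosceles property. -/
theorem HasEquidistantExtension.exists_dist_eq_dist [IsUltrametricDist X]
    (hX : HasEquidistantExtension R X) (hZ : IsValuedUltrametric R Z) {C : Set Z} (hC : C.Finite)
    {F : Z → X} (hF : ∀ a ∈ C, ∀ b ∈ C, dist (F a) (F b) = dist a b) (z : Z) :
    ∃ p, ∀ b ∈ C, dist p (F b) = dist z b := by
  have := hZ.ultra
  by_cases hz : z ∈ C
  · exact ⟨F z, hF z hz⟩
  rcases C.eq_empty_or_nonempty with rfl | hne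
  · exact ⟨Classical.arbitrary X, fun b hb => hb.elim⟩
  obtain ⟨b₀, hb₀, hmin⟩ := exists_min_image C (dist z) hC hne
  have hpos : 0 < dist z b₀ := dist_pos.2 fun h => hz (h ▸ hb₀)
  let N : Set Z := {b ∈ C | dist z b = dist z b₀}
  have hN : ∀ x ∈ F '' N, ∀ y ∈ F '' N, dist x y ≤ dist z b₀ := by
    rintro _ ⟨a, ha, rfl⟩ _ ⟨b, hb, rfl⟩
    rw [hF a ha.1 b hb.1]
    exact (dist_triangle_max a z b).trans (max_le (dist_comm a z ▸ ha.2.le) hb.2.le)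
  obtain ⟨p, hp⟩ := hX _ (hZ.dist_mem z b₀) hpos (F '' N) ((hC.sep _).image F) hN
  refine ⟨p, fun b hb => ?_⟩
  rcases (hmin b hb).eq_or_lt with h | h
  · exact (hp _ (mem_image_of_mem F ⟨hb, h.symm⟩)).trans h
  have hpb₀ : dist p (F b₀) = dist z b₀ := hp _ (mem_image_of_mem F ⟨hb₀, rfl⟩)
  have hb₀b : dist b₀ b = dist z b := dist_eq_of_dist_lt (dist_comm b₀ z ▸ h)
  have hFb : dist (F b₀) (F b) = dist z b := (hF _ hb₀ _ hb).trans hb₀b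
  rw [dist_eq_of_dist_lt (hpb₀.trans_lt (hFb ▸ h)), hFb]

theorem HasEquidistantExtension.isFiniteUltrametricInjective
    (hX : HasEquidistantExtension R X) (hv : IsValuedUltrametric R X) :
    IsFiniteUltrametricInjective R X := by
  classical
  have := hv.ultra
  refine ⟨inferInstance, fun Y Z _ _ _ _ _ hZ φ f hφ hf => ?_⟩
  suffices H : ∀ B : Set Z, ∃ F : Z → X, (∀ y, F (φ y) = f y) ∧
      ∀ a ∈ range φ ∪ B, ∀ b ∈ range φ ∪ B, dist (F a) (F b) = dist a b by
    obtain ⟨F, hFφ, hF⟩ := H univ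
    exact ⟨F, Isometry.of_dist_eq fun a b => hF a (by simp) b (by simp), funext hFφ⟩
  intro B
  induction B, B.toFinite using Set.Finite.induction_on with
  | empty =>
    refine ⟨Function.extend φ f fun _ => Classical.arbitrary X,
      hφ.injective.extend_apply _ _, ?_⟩
    rw [union_empty]
    rintro _ ⟨a, rfl⟩ _ ⟨b, rfl⟩
    rw [hφ.injective.extend_apply, hφ.injective.extend_apply, hf.dist_eq, hφ.dist_eq]
  | @insert z B _ _ ih =>
    obtain ⟨F, hFφ, hF⟩ := ih
    rw [union_insert]
    by_cases hz : z ∈ range φ ∪ B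
    · rw [insert_eq_of_mem hz]
      exact ⟨F, hFφ, hF⟩
    obtain ⟨p, hp⟩ := hX.exists_dist_eq_dist hZ (toFinite (range φ ∪ B)) hF z
    have hne : ∀ b ∈ range φ ∪ B, Function.update F z p b = F b := fun b hb =>
      Function.update_of_ne (ne_of_mem_of_not_mem hb hz) _ _
    refine ⟨Function.update F z p, fun y => ?_, ?_⟩
    · rw [hne _ (Or.inl (mem_range_self y)), hFφ]
    rintro a (rfl | ha) b (rfl | hb)
    · simp
    · rw [Function.update_self, hne b hb, hp b hb]
    · rw [Function.update_self, hne a ha, dist_comm, hp a ha, dist_comm]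
    · rw [hne a ha, hne b hb, hF a ha b hb]

end HasEquidistantExtension

theorem IsSeparableUrysohnUltrametric.of_isometryEquiv {R : Set ℝ} {X Y : Type*} [MetricSpace X]
    [MetricSpace Y] (e : X ≃ᵢ Y) (hX : IsSeparableUrysohnUltrametric R X) :
    IsSeparableUrysohnUltrametric R Y := by
  have := hX.separable
  have := hX.complete
  refine ⟨e.surjective.denseRange.separableSpace e.continuous, e.symm.completeSpace,
    ⟨hX.injective.1.map e, fun A B _ _ _ _ hA hB φ f hφ hf => ?_⟩,
    hX.valued.of_isometry e.symm.isometry⟩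
  obtain ⟨F, hF, hFφ⟩ := hX.injective.2 A B hA hB φ (e.symm ∘ f) hφ (e.symm.isometry.comp hf)
  refine ⟨e ∘ F, e.isometry.comp hF, ?_⟩
  rw [Function.comp_assoc, hFφ, ← Function.comp_assoc, e.self_comp_symm, Function.id_comp]

section NonemptyCompacts

variable {X : Type*}

theorem isClosed_setOf_encard_le [TopologicalSpace X] [T2Space X] (m : ℕ∞) :
    IsClosed {E : NonemptyCompacts X | (E : Set X).encard ≤ m} := by
  refine isOpen_compl_iff.1 (isOpen_iff_mem_nhds.2 fun E hE => ?_)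
  have hlt : m < (E : Set X).encard := lt_of_not_ge hE
  have hm : m ≠ ⊤ := hlt.ne_top
  obtain ⟨t, htE, ht⟩ := exists_subset_encard_eq (Order.add_one_le_of_lt hlt)
  have htfin : t.Finite :=
    encard_ne_top_iff.1 (ht ▸ WithTop.add_ne_top.2 ⟨hm, ENat.one_ne_top⟩)
  obtain ⟨U, hU, hdisj⟩ := htfin.t2_separation
  have hnhds : (⋂ x ∈ t, {F : NonemptyCompacts X | ((F : Set X) ∩ U x).Nonempty}) ∈ 𝓝 E :=
    (biInter_mem htfin).2 fun x hx =>
      (NonemptyCompacts.isOpen_inter_nonempty_of_isOpen (hU x).2).mem_nhds ⟨x, htE hx, (hU x).1⟩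
  filter_upwards [hnhds] with F hF
  choose! g hgF hgU using fun x (hx : x ∈ t) => mem_iInter₂.1 hF x hx
  have hinj : InjOn g t := fun x hx y hy hxy =>
    hdisj.elim_set hx hy (g x) (hgU x hx) (hxy ▸ hgU y hy)
  have hcard : m + 1 ≤ (F : Set X).encard := by
    rw [← ht, ← hinj.encard_image]
    exact encard_le_encard (image_subset_iff.2 hgF)
  exact not_le.2 ((ENat.lt_add_one_iff hm).2 le_rfl |>.trans_le hcard)

variable [MetricSpace X]

theorem isClosed_setOf_ediam_le (l : ℝ≥0∞) :
    IsClosed {E : NonemptyCompacts X | Metric.ediam (E : Set X) ≤ l} := by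
  have hcl : IsClosed {p : X × X | edist p.1 p.2 ≤ l} :=
    isClosed_le continuous_edist continuous_const
  have hsq : Continuous fun E : NonemptyCompacts X => E ×ˢ E :=
    NonemptyCompacts.continuous_prod.comp (continuous_id.prodMk continuous_id)
  convert (NonemptyCompacts.isClosed_subsets_of_isClosed hcl).preimage hsq using 1
  ext E
  simp only [mem_ofPred_eq, mem_preimage, Metric.ediam_le_iff, subset_def, Prod.forall,
    NonemptyCompacts.coe_prod, mem_prod, and_imp]
  exact ⟨fun h x y hx hy => h x hx y hy, fun h x hx y hy => h x y hx hy⟩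

variable (E F : NonemptyCompacts X)

theorem exists_dist_le_hausdorffDist {x : X} (hx : x ∈ (E : Set X)) :
    ∃ y ∈ (F : Set X), dist x y ≤ dist E F := by
  obtain ⟨y, hy, h⟩ := F.isCompact.exists_infDist_eq_dist F.nonempty x
  exact ⟨y, hy, h ▸ Metric.infDist_le_hausdorffDist_of_mem hx (edist_ne_top E F)⟩

theorem exists_hausdorffDist_eq_dist :
    ∃ x ∈ (E : Set X), ∃ y ∈ (F : Set X), dist E F = dist x y := by
  obtain ⟨x, hx, hmaxE⟩ := E.isCompact.exists_isMaxOn E.nonempty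
    (Metric.continuous_infDist_pt (F : Set X)).continuousOn
  obtain ⟨y, hy, hmaxF⟩ := F.isCompact.exists_isMaxOn F.nonempty
    (Metric.continuous_infDist_pt (E : Set X)).continuousOn
  have hdist : dist E F = max (Metric.infDist x F) (Metric.infDist y E) := by
    refine le_antisymm ?_ (max_le ?_ ?_)
    · exact Metric.hausdorffDist_le_of_infDist (le_max_of_le_left Metric.infDist_nonneg)
        (fun z hz => le_max_of_le_left (hmaxE hz)) fun z hz => le_max_of_le_right (hmaxF hz)
    · exact Metric.infDist_le_hausdorffDist_of_mem hx (edist_ne_top E F)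
    · exact dist_comm F E ▸ Metric.infDist_le_hausdorffDist_of_mem hy (edist_ne_top F E)
  rcases max_choice (Metric.infDist x F) (Metric.infDist y E) with h | h
  · obtain ⟨z, hz, hxz⟩ := F.isCompact.exists_infDist_eq_dist F.nonempty x
    exact ⟨x, hx, z, hz, by rw [hdist, h, hxz]⟩
  · obtain ⟨z, hz, hyz⟩ := E.isCompact.exists_infDist_eq_dist E.nonempty y
    exact ⟨z, hz, y, hy, by rw [hdist, h, hyz, dist_comm]⟩

variable {E F} in
theorem dist_nonemptyCompacts_le {r : ℝ} (hEF : ∀ x ∈ (E : Set X), ∃ y ∈ (F : Set X), dist x y ≤ r)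
    (hFE : ∀ y ∈ (F : Set X), ∃ x ∈ (E : Set X), dist y x ≤ r) : dist E F ≤ r := by
  obtain ⟨x, hx⟩ := E.nonempty
  obtain ⟨y, -, hxy⟩ := hEF x hx
  exact Metric.hausdorffDist_le_of_mem_dist (dist_nonneg.trans hxy) hEF hFE

instance isUltrametricDist_nonemptyCompacts [IsUltrametricDist X] :
    IsUltrametricDist (NonemptyCompacts X) := by
  have key (E F G : NonemptyCompacts X) (x : X) (hx : x ∈ (E : Set X)) :
      ∃ z ∈ (G : Set X), dist x z ≤ max (dist E F) (dist F G) := by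
    obtain ⟨y, hy, hxy⟩ := exists_dist_le_hausdorffDist E F hx
    obtain ⟨z, hz, hyz⟩ := exists_dist_le_hausdorffDist F G hy
    exact ⟨z, hz, (dist_triangle_max x y z).trans (max_le_max hxy hyz)⟩
  refine ⟨fun E F G => dist_nonemptyCompacts_le (key E F G) fun z hz => ?_⟩
  rw [dist_comm E F, dist_comm F G, max_comm]
  exact key G F E z hz

end NonemptyCompacts

theorem lipschitzWith_ite_dist_le {X : Type*} [MetricSpace X] [IsUltrametricDist X] (p : X)
    (r : ℝ) [DecidablePred fun x => dist x p ≤ r] :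
    LipschitzWith 1 fun x => if dist x p ≤ r then p else x := by
  have key {x y : X} (hx : dist x p ≤ r) (hy : ¬ dist y p ≤ r) : dist p y = dist x y := by
    rw [dist_comm y p] at hy
    exact (dist_eq_of_dist_lt (hx.trans_lt (not_le.1 hy))).symm
  refine .mk_one fun x y => ?_
  by_cases hx : dist x p ≤ r <;> by_cases hy : dist y p ≤ r
  · simp only [if_pos hx, if_pos hy, dist_self, dist_nonneg]
  · simp only [if_pos hx, if_neg hy, key hx hy, le_rfl]
  · rw [if_neg hx, if_pos hy, dist_comm x p, key hy hx, dist_comm]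
  · simp only [if_neg hx, if_neg hy, le_rfl]

/-- Moving all points of an `ε`-ball to one and the same point of `A` near it does not increase
distances. -/
theorem exists_mapsTo_lipschitzOnWith {X : Type*} [MetricSpace X] [IsUltrametricDist X]
    {E A : Set X} {ε : ℝ} (hEA : ∀ y ∈ E, ∃ a ∈ A, dist y a < ε) :
    ∃ h : X → X, MapsTo h E A ∧ LipschitzOnWith 1 h E ∧ ∀ y ∈ E, dist y (h y) < ε := by
  rcases E.eq_empty_or_nonempty with rfl | ⟨e, -⟩
  · exact ⟨id, mapsTo_empty _ _, lipschitzOnWith_empty _ _, fun y hy => hy.elim⟩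
  have : Nonempty X := ⟨e⟩
  choose! f hf using fun (U : Set X) (hU : (U ∩ A).Nonempty) => hU
  have hball : ∀ y ∈ E, f (Metric.ball y ε) ∈ Metric.ball y ε ∩ A := fun y hy => by
    obtain ⟨a, haA, hya⟩ := hEA y hy
    exact hf _ ⟨a, Metric.mem_ball'.2 hya, haA⟩
  have hlt : ∀ y ∈ E, dist y (f (Metric.ball y ε)) < ε := fun y hy =>
    Metric.mem_ball'.1 (hball y hy).1
  refine ⟨fun y => f (Metric.ball y ε), fun y hy => (hball y hy).2,
    .mk_one fun y hy z hz => ?_, hlt⟩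
  rcases lt_or_ge (dist y z) ε with hyz | hyz
  · rw [IsUltrametricDist.ball_eq_of_mem (show y ∈ Metric.ball z ε from hyz), dist_self]
    exact dist_nonneg
  calc dist (f (Metric.ball y ε)) (f (Metric.ball z ε))
      ≤ max (dist (f (Metric.ball y ε)) y) (dist y (f (Metric.ball z ε))) :=
        dist_triangle_max _ _ _
    _ ≤ max (dist (f (Metric.ball y ε)) y) (max (dist y z) (dist z (f (Metric.ball z ε)))) :=
        max_le_max_left _ (dist_triangle_max _ _ _)
    _ ≤ dist y z := max_le (Metric.mem_ball.1 (hball y hy).1 |>.le.trans hyz)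
        (max_le le_rfl ((hlt z hz).le.trans hyz))

/-- Finite sets can be replaced by compact ones, at the price of merely bounding the distances to
their points from below. -/
theorem HasEquidistantExtension.exists_forall_le_dist {X : Type*} [MetricSpace X]
    [IsUltrametricDist X] {R : Set ℝ} (hX : HasEquidistantExtension R X) {r : ℝ} (hrR : r ∈ R)
    (hr : 0 < r) {K : Set X} (hK : IsCompact K) (x : X) :
    ∃ p, dist x p = r ∧ ∀ y ∈ K, r ≤ dist p y := by
  obtain ⟨t, -, ht, htK⟩ := hK.finite_cover_balls hr
  have hsub : insert x (t ∩ Metric.closedBall x r) ⊆ Metric.closedBall x r :=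
    insert_subset (Metric.mem_closedBall_self hr.le) inter_subset_right
  obtain ⟨p, hp⟩ := hX r hrR hr (insert x (t ∩ Metric.closedBall x r))
    ((ht.inter_of_left _).insert x) fun y hy z hz =>
      (dist_triangle_max y x z).trans (max_le (hsub hy) (Metric.mem_closedBall'.1 (hsub hz)))
  have hxp : dist x p = r := dist_comm x p ▸ hp x (mem_insert _ _)
  refine ⟨p, hxp, fun y hy => ?_⟩
  by_contra! hpy
  obtain ⟨z, hz, hyz⟩ := mem_iUnion₂.1 (htK hy)
  have hpz : dist p z < r := (dist_triangle_max p y z).trans_lt (max_lt hpy hyz)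
  have hxz : dist x z ≤ r := (dist_triangle_max x p z).trans (max_le hxp.le hpz.le)
  exact hpz.ne (hp z (mem_insert_of_mem _ ⟨hz, Metric.mem_closedBall'.2 hxz⟩))

section BoundedHyperspace

variable {X Y : Type*} [MetricSpace X] [MetricSpace Y] {m : ℕ∞} {l : ℝ≥0∞} {R : Set ℝ}

namespace BoundedHyperspace

instance completeSpace [CompleteSpace X] : CompleteSpace (BoundedHyperspace X m l) :=
  ((isClosed_setOf_encard_le m).inter (isClosed_setOf_ediam_le l)).completeSpace_coe

/-- A one-point set as a point of the bounded hyperspace. -/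
def singleton (hm : 1 ≤ m) (x : X) : BoundedHyperspace X m l :=
  ⟨{x}, by simpa using hm, by simp⟩

/-- The image of a compact set under a map that does not increase distances on it, so that the
bounds on the number of points and on the diameter are preserved. -/
def image (E : BoundedHyperspace X m l) (h : X → Y) (hh : LipschitzOnWith 1 h (E.1 : Set X)) :
    BoundedHyperspace Y m l :=
  ⟨⟨⟨h '' E.1, E.1.isCompact.image_of_continuousOn hh.continuousOn⟩, E.1.nonempty.image h⟩,
    (encard_image_le _ _).trans E.2.1, Metric.ediam_image_le_iff.2 fun _ hx _ hy =>
      (hh hx hy).trans (by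
        simpa only [ENNReal.coe_one, one_mul] using
          (Metric.edist_le_ediam_of_mem hx hy).trans E.2.2)⟩

theorem dist_image_le (E : BoundedHyperspace X m l) {h : X → X}
    (hh : LipschitzOnWith 1 h (E.1 : Set X)) {r : ℝ} (hr : ∀ x ∈ (E.1 : Set X), dist x (h x) ≤ r) :
    dist E (E.image h hh) ≤ r := by
  refine dist_nonemptyCompacts_le (fun x hx => ⟨h x, mem_image_of_mem h hx, hr x hx⟩) ?_
  rintro _ ⟨x, hx, rfl⟩
  exact ⟨x, hx, dist_comm x (h x) ▸ hr x hx⟩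

theorem nonempty_isometryEquiv_range {f : X → Y} (hf : Isometry f) :
    Nonempty (BoundedHyperspace X m l ≃ᵢ
      {E : BoundedHyperspace Y m l | (E.1 : Set Y) ⊆ range f}) := by
  let g : BoundedHyperspace X m l → {E : BoundedHyperspace Y m l | (E.1 : Set Y) ⊆ range f} :=
    fun E => ⟨E.image f hf.lipschitz.lipschitzOnWith, image_subset_range f _⟩
  have hg : Isometry g := Isometry.of_dist_eq fun E F => Metric.hausdorffDist_image hf
  refine ⟨IsometryEquiv.mk (Equiv.ofBijective g ⟨hg.injective, fun ⟨E, hE⟩ => ?_⟩) hg⟩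
  have himage : f '' (f ⁻¹' (E.1 : Set Y)) = E.1 := image_preimage_eq_of_subset hE
  refine ⟨⟨⟨⟨f ⁻¹' (E.1 : Set Y),
    (hf.isEmbedding.isInducing.isCompact_preimage_iff hE).2 E.1.isCompact⟩,
    image_nonempty.1 (himage ▸ E.1.nonempty)⟩, ?_, ?_⟩, ?_⟩
  · rw [← hf.injective.encard_image]
    exact (congrArg encard himage).trans_le E.2.1
  · rw [← hf.ediam_image]
    exact (congrArg Metric.ediam himage).trans_le E.2.2
  · exact Subtype.ext (Subtype.ext (NonemptyCompacts.ext himage))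

theorem exists_infDist_eq [IsUltrametricDist X] {A : Set X} (hA : A.Nonempty)
    (E : BoundedHyperspace X m l) :
    ∃ x ∈ (E.1 : Set X), Metric.infDist E {F : BoundedHyperspace X m l | (F.1 : Set X) ⊆ A} =
      Metric.infDist x A := by
  obtain ⟨x, hx, hmax⟩ := E.1.isCompact.exists_isMaxOn E.1.nonempty
    (Metric.continuous_infDist_pt A).continuousOn
  refine ⟨x, hx, le_antisymm (le_of_forall_gt_imp_ge_of_dense fun ε hε => ?_) ?_⟩
  · obtain ⟨h, hhA, hh, hhε⟩ := exists_mapsTo_lipschitzOnWith fun y hy =>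
      (Metric.infDist_lt_iff hA).1 ((hmax hy).trans_lt hε)
    exact (Metric.infDist_le_dist_of_mem (y := E.image h hh) hhA.image_subset).trans
      (E.dist_image_le hh fun y hy => (hhε y hy).le)
  · obtain ⟨a, ha⟩ := hA
    have hne : {F : BoundedHyperspace X m l | (F.1 : Set X) ⊆ A}.Nonempty :=
      ⟨E.image (fun _ => a) (LipschitzWith.const' a).lipschitzOnWith,
        image_subset_iff.2 fun _ _ => ha⟩
    refine (Metric.le_infDist hne).2 fun G hG => ?_
    obtain ⟨y, hy, hxy⟩ := exists_dist_le_hausdorffDist E.1 G.1 hx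
    exact (Metric.infDist_le_dist_of_mem (hG hy)).trans hxy

end BoundedHyperspace

theorem IsValuedUltrametric.boundedHyperspace (hX : IsValuedUltrametric R X) :
    IsValuedUltrametric R (BoundedHyperspace X m l) := by
  have := hX.ultra
  refine ⟨⟨fun E F G => dist_triangle_max E.1 F.1 G.1⟩, fun E F => ?_⟩
  obtain ⟨x, -, y, -, h⟩ := exists_hausdorffDist_eq_dist E.1 F.1
  exact (show dist E F = dist x y from h) ▸ hX.dist_mem x y

/-- Collapse the closed `r`-ball around a point of one of the given sets to a point of that ball
at distance at least `r` from all of them. -/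
theorem HasEquidistantExtension.boundedHyperspace [IsUltrametricDist X]
    (hX : HasEquidistantExtension R X) [Nonempty (BoundedHyperspace X m l)] :
    HasEquidistantExtension R (BoundedHyperspace X m l) := by
  classical
  intro r hrR hr A hA hAr
  rcases A.eq_empty_or_nonempty with rfl | ⟨E, hE⟩
  · exact ⟨Classical.arbitrary _, fun F hF => hF.elim⟩
  obtain ⟨e, he⟩ := E.1.nonempty
  obtain ⟨p, hep, hp⟩ := hX.exists_forall_le_dist hrR hr
    (hA.isCompact_biUnion fun F _ => F.1.isCompact) e
  let h : X → X := fun x => if dist x p ≤ r then p else x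
  let F : BoundedHyperspace X m l :=
    E.image h (lipschitzWith_ite_dist_le p r).lipschitzOnWith
  have hEF : dist E F ≤ r := E.dist_image_le _ fun x _ => by
    by_cases hx : dist x p ≤ r
    · rwa [show h x = p from if_pos hx]
    · rw [show h x = x from if_neg hx, dist_self]
      exact hr.le
  have hpF : p ∈ (F.1 : Set X) := ⟨e, he, if_pos hep.le⟩
  refine ⟨F, fun G hG => le_antisymm ?_ ?_⟩
  · exact (dist_triangle_max F.1 E.1 G.1).trans (max_le (dist_comm E F ▸ hEF) (hAr E hE G hG))
  · obtain ⟨y, hy, hpy⟩ := exists_dist_le_hausdorffDist F.1 G.1 hpF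
    exact (hp y (mem_biUnion hG hy)).trans hpy

theorem IsSeparableUrysohnUltrametric.boundedHyperspace (h0 : 0 ∈ R) (hm : 1 ≤ m)
    (hX : IsSeparableUrysohnUltrametric R X) :
    IsSeparableUrysohnUltrametric R (BoundedHyperspace X m l) := by
  have := hX.valued.ultra
  have := hX.complete
  have := hX.separable
  have : SecondCountableTopology X := UniformSpace.secondCountable_of_separable X
  have : Nonempty (BoundedHyperspace X m l) := hX.injective.1.map (.singleton hm)
  have hv : IsValuedUltrametric R (BoundedHyperspace X m l) := hX.valued.boundedHyperspace
  have hext : HasEquidistantExtension R (BoundedHyperspace X m l) :=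
    (hX.injective.hasEquidistantExtension h0 hX.valued).boundedHyperspace
  exact ⟨inferInstance, inferInstance, hext.isFiniteUltrametricInjective hv, hv⟩

end BoundedHyperspace

theorem IsRangeSet.exists_pos_mem_ne {R : Set ℝ} (hR : IsRangeSet R) (hc : ¬ R.Countable) (r : ℝ) :
    ∃ a ∈ R, 0 < a ∧ a ≠ r := by
  by_contra! h
  refine hc ((toFinite {0, r}).countable.mono fun x hx => ?_)
  rcases (mem_Ici.1 (hR.1 hx)).eq_or_lt with h0 | h0
  exacts [Or.inl h0.symm, Or.inr (h x hx h0)]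

theorem ne_singleton_zero_of_mem {S : Set ℝ} {a : ℝ} (haS : a ∈ S) (ha : 0 < a) : S ≠ {0} := by
  rintro rfl
  exact ha.ne' haS

theorem exists_dist_le_of_infDist_le {X : Type*} [MetricSpace X] {A : Set X} (hA : A.Nonempty)
    {x : X} (hxA : IsFiniteAwayFromZero (dist x '' A)) {r : ℝ} (hr : 0 < r)
    (h : Metric.infDist x A ≤ r) : ∃ y ∈ A, dist x y ≤ r := by
  by_contra! hlt
  have hfin : (dist x '' A).Finite :=
    (hxA r hr).subset (subset_inter subset_rfl (image_subset_iff.2 fun y hy => (hlt y hy).le))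
  obtain ⟨_, ⟨y, hy, rfl⟩, hmin⟩ := exists_min_image _ id hfin (hA.image (dist x))
  have hle : dist x y ≤ Metric.infDist x A :=
    (Metric.le_infDist hA).2 fun z hz => hmin _ (mem_image_of_mem _ hz)
  exact (hlt y hy).not_ge (hle.trans h)

namespace IsPetal

variable {X : Type*} [MetricSpace X] {R S T : Set ℝ} {P : Set ℝ → Set X}

theorem mono (hP : IsPetal R X P) (hS : S ∈ tenuousRangeSubsets R)
    (hT : T ∈ tenuousRangeSubsets R) (h : S ⊆ T) : P S ⊆ P T := by
  rw [← inter_eq_left, hP.inter_eq S hS T hT, inter_eq_left.2 h]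

theorem exists_mem (hP : IsPetal R X P) (x : X) : ∃ S ∈ tenuousRangeSubsets R, x ∈ P S := by
  simpa only [mem_iUnion, exists_prop] using hP.iUnion_eq.ge (mem_univ x)

theorem isComplete (hP : IsPetal R X P) (hS : S ∈ tenuousRangeSubsets R) (hS0 : S ≠ {0}) :
    IsComplete (P S) :=
  completeSpace_coe_iff_isComplete.1 (hP.urysohn S hS hS0).complete

theorem mem_of_infDist_lt (hP : IsPetal R X P) (hS : S ∈ tenuousRangeSubsets R) (hS0 : S ≠ {0})
    (hT : T ∈ tenuousRangeSubsets R) {x : X} (hx : x ∈ P T) {r : ℝ} (hTS : T ∩ Iio r ⊆ S)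
    (h : Metric.infDist x (P S) < r) : x ∈ P S := by
  rw [← (hP.isComplete hS hS0).isClosed.closure_eq,
    Metric.mem_closure_iff_infDist_zero (hP.nonempty S hS)]
  exact (hP.infDist_mem S hS T hT x hx).resolve_right fun hd => hd.2 (hTS ⟨hd.1, h⟩)

/-- Take finite nets of `K` with mesh tending to zero. Once `S` contains all distances that occur
at the points of the coarsest net, each finer net requires only additional distances below the
mesh of the preceding one, so that `S` remains tenuous. -/
theorem exists_superset (hP : IsPetal R X P) (hR : IsRangeSet R) (hc : ¬ R.Countable)
    {K : Set X} (hK : TotallyBounded K) : ∃ S ∈ tenuousRangeSubsets R, S ≠ {0} ∧ K ⊆ P S := by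
  obtain ⟨a, haR, ha, -⟩ := hR.exists_pos_mem_ne hc 0
  choose T hT hxT using hP.exists_mem
  have hT' := fun x => (mem_tenuousRangeSubsets hR).1 (hT x)
  choose F hFK hF hKF using fun n : ℕ =>
    Metric.finite_approx_of_totallyBounded hK (1 / ((n : ℝ) + 1)) Nat.one_div_pos_of_nat
  obtain ⟨S₀, hS₀, hF0, hFn⟩ := exists_mem_tenuousRangeSubsets_superset hR
    (U := fun n => ⋃ x ∈ F n, T x) (fun n => .biUnion (hF n) fun x _ => (hT' x).2.1)
    (fun n => iUnion₂_subset fun x _ => (hT' x).2.2) tendsto_one_div_add_atTop_nhds_zero_nat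
  have hS : insert a S₀ ∈ tenuousRangeSubsets R := insert_mem_tenuousRangeSubsets hR hS₀ haR
  have hS0 : insert a S₀ ≠ {0} := ne_singleton_zero_of_mem (mem_insert a S₀) ha
  have hFS : ∀ n, F n ⊆ P (insert a S₀) := by
    intro n
    induction n with
    | zero =>
      exact fun x hx => hP.mono (hT x) hS
        (fun s hs => Or.inr (hF0 (mem_biUnion hx hs))) (hxT x)
    | succ n ih =>
      intro x hx
      obtain ⟨y, hy, hxy⟩ := mem_iUnion₂.1 (hKF n (hFK (n + 1) hx))
      exact hP.mem_of_infDist_lt hS hS0 (hT x) (hxT x)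
        (fun s hs => Or.inr (hFn n ⟨mem_biUnion hx hs.1, hs.2⟩))
        ((Metric.infDist_le_dist_of_mem (ih hy)).trans_lt hxy)
  refine ⟨_, hS, hS0, fun x hx => ?_⟩
  rw [← (hP.isComplete hS hS0).isClosed.closure_eq, Metric.mem_closure_iff]
  intro ε hε
  obtain ⟨n, hn⟩ := exists_nat_one_div_lt hε
  obtain ⟨y, hy, hxy⟩ := mem_iUnion₂.1 (hKF n hx)
  exact ⟨y, hFS n hy, hxy.trans hn⟩

theorem completeSpace (hP : IsPetal R X P) (hR : IsRangeSet R) (hc : ¬ R.Countable) :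
    CompleteSpace X := by
  refine Metric.complete_of_cauchySeq_tendsto fun u hu => ?_
  obtain ⟨S, hS, hS0, h⟩ := hP.exists_superset hR hc hu.totallyBounded_range
  obtain ⟨x, -, hx⟩ := cauchySeq_tendsto_of_isComplete (hP.isComplete hS hS0)
    (fun n => h (mem_range_self n)) hu
  exact ⟨x, hx⟩

theorem hasEquidistantExtension (hP : IsPetal R X P) (hR : IsRangeSet R) (hc : ¬ R.Countable) :
    HasEquidistantExtension R X := by
  intro r hr hr0 A hA hAr
  obtain ⟨S, hS, -, hAS⟩ := hP.exists_superset hR hc hA.totallyBounded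
  have hT := insert_mem_tenuousRangeSubsets hR hS hr
  have hST := hP.mono hS hT (subset_insert r S)
  have hU := hP.urysohn _ hT (ne_singleton_zero_of_mem (mem_insert r S) hr0)
  obtain ⟨p, hp⟩ := hU.injective.hasEquidistantExtension hT.1.2 hU.valued r (mem_insert r S) hr0
    (Subtype.val ⁻¹' A) (hA.preimage Subtype.val_injective.injOn)
    (fun x hx y hy => hAr x hx y hy)
  exact ⟨p, fun x hx => hp ⟨x, hST (hAS hx)⟩ hx⟩

theorem dist_mem (hP : IsPetal R X P) (hR : IsRangeSet R) (hc : ¬ R.Countable)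
    (hS : S ∈ tenuousRangeSubsets R) {x y : X} (hx : x ∈ P S) (hy : y ∈ P S) : dist x y ∈ S := by
  obtain ⟨a, haR, ha, hne⟩ := hR.exists_pos_mem_ne hc (dist x y)
  have hT := insert_mem_tenuousRangeSubsets hR hS haR
  have hST := hP.mono hS hT (subset_insert a S)
  have hU := hP.urysohn _ hT (ne_singleton_zero_of_mem (mem_insert a S) ha)
  exact (hU.valued.dist_mem ⟨x, hST hx⟩ ⟨y, hST hy⟩).resolve_left hne.symm

theorem dist_mem_union (hP : IsPetal R X P) (hR : IsRangeSet R) (hc : ¬ R.Countable)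
    (hS : S ∈ tenuousRangeSubsets R) (hT : T ∈ tenuousRangeSubsets R) {x y : X} (hx : x ∈ P S)
    (hy : y ∈ P T) : dist x y ∈ S ∪ T :=
  have hU := union_mem_tenuousRangeSubsets hR hS hT
  hP.dist_mem hR hc hU (hP.mono hS hU subset_union_left hx) (hP.mono hT hU subset_union_right hy)

theorem exists_dist_lt (hP : IsPetal R X P) (hS : S ∈ tenuousRangeSubsets R)
    (hT : T ∈ tenuousRangeSubsets R) {x : X} (hx : x ∈ P T) {r : ℝ} (hr : 0 < r)
    (h : T \ S ⊆ Iio r) : ∃ y ∈ P S, dist x y < r := by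
  refine (Metric.infDist_lt_iff (hP.nonempty S hS)).1 ?_
  rcases hP.infDist_mem S hS T hT x hx with h0 | hTS
  · rwa [mem_singleton_iff.1 h0]
  · exact h hTS

theorem exists_dist_le (hP : IsPetal R X P) (hR : IsRangeSet R) (hc : ¬ R.Countable)
    (hS : S ∈ tenuousRangeSubsets R) (hT : T ∈ tenuousRangeSubsets R) {x : X} (hx : x ∈ P T)
    {r : ℝ} (hr : 0 < r) (h : T \ S ⊆ Iic r) : ∃ y ∈ P S, dist x y ≤ r := by
  have hU := ((mem_tenuousRangeSubsets hR).1 (union_mem_tenuousRangeSubsets hR hT hS)).2.1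
  refine exists_dist_le_of_infDist_le (hP.nonempty S hS) (hU.mono ?_) hr ?_
  · rintro _ ⟨y, hy, rfl⟩
    exact hP.dist_mem_union hR hc hT hS hx hy
  · rcases hP.infDist_mem S hS T hT x hx with h0 | hTS
    · exact (mem_singleton_iff.1 h0).trans_le hr.le
    · exact h hTS

theorem boundedHyperspace [IsUltrametricDist X] (hP : IsPetal R X P) (hR : IsRangeSet R)
    (hc : ¬ R.Countable) {m : ℕ∞} {l : ℝ≥0∞} (hm : 1 ≤ m) :
    IsPetal R (BoundedHyperspace X m l)
      (fun S => {E : BoundedHyperspace X m l | (E.1 : Set X) ⊆ P S}) where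
  nonempty S hS :=
    let ⟨x, hx⟩ := hP.nonempty S hS
    ⟨.singleton hm x, singleton_subset_iff.2 hx⟩
  urysohn S hS hS0 := by
    obtain ⟨e⟩ := BoundedHyperspace.nonempty_isometryEquiv_range (m := m) (l := l)
      (isometry_subtype_coe (s := P S))
    rw [Subtype.range_coe] at e
    exact ((hP.urysohn S hS hS0).boundedHyperspace hS.1.2 hm).of_isometryEquiv e
  iUnion_eq := eq_univ_of_forall fun E =>
    let ⟨_, hS, _, h⟩ := hP.exists_superset hR hc E.1.isCompact.totallyBounded
    mem_biUnion hS h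
  inter_eq S hS T hT := by
    ext E
    rw [mem_inter_iff, mem_ofPred_eq, mem_ofPred_eq, mem_ofPred_eq, ← hP.inter_eq S hS T hT,
      subset_inter_iff]
  infDist_mem S hS T hT E hE := by
    obtain ⟨x, hx, h⟩ := BoundedHyperspace.exists_infDist_eq (hP.nonempty S hS) E
    exact h ▸ hP.infDist_mem S hS T hT x (hE hx)

end IsPetal

/-- The functions whose support consists of positive elements of `R` and is finite away from zero.
With the largest number at which two of them differ as their distance, they form the model of the
`R`-Urysohn universal ultrametric space. -/
def sparseFunctions (R : Set ℝ) : Set (ℝ → ℕ) :=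
  {f | Function.support f ⊆ R ∩ Ioi 0 ∧ IsFiniteAwayFromZero (Function.support f)}

/-- A family of coordinates on `X`, indexed by the real numbers, from which the distance of two
points is recovered as the largest positive index at which their coordinates differ. -/
def IsBallLabelling {X ι : Type*} [MetricSpace X] (L : X → ℝ → ι) : Prop :=
  ∀ x y r, 0 < r → (dist x y < r ↔ EqOn (L x) (L y) (Ici r))

namespace IsBallLabelling

variable {X Y ι : Type*} [MetricSpace X] [MetricSpace Y] {L : X → ℝ → ι} {M : Y → ℝ → ι}

theorem injective (hL : IsBallLabelling L) : Function.Injective L := fun x y h =>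
  dist_le_zero.1 (le_of_forall_gt fun r hr => (hL x y r hr).2 fun _ _ => congrFun h _)

theorem dist_le_dist (hL : IsBallLabelling L) (hM : IsBallLabelling M) {x y : X} {x' y' : Y}
    (hx : L x = M x') (hy : L y = M y') : dist x y ≤ dist x' y' :=
  le_of_forall_gt fun r hr => by
    have hr0 := dist_nonneg.trans_lt hr
    rwa [hL x y r hr0, hx, hy, ← hM x' y' r hr0]

theorem nonempty_isometryEquiv (hL : IsBallLabelling L) (hM : IsBallLabelling M)
    (h : range L = range M) : Nonempty (X ≃ᵢ Y) := by
  choose f hf using fun x => h.le (mem_range_self x)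
  have hf_isom : Isometry f := Isometry.of_dist_eq fun x y =>
    (hM.dist_le_dist hL (hf x) (hf y)).antisymm (hL.dist_le_dist hM (hf x).symm (hf y).symm)
  have hf_surj : Function.Surjective f := fun y =>
    let ⟨x, hx⟩ := h.ge (mem_range_self y)
    ⟨x, hM.injective ((hf x).trans hx)⟩
  exact ⟨⟨Equiv.ofBijective f ⟨hf_isom.injective, hf_surj⟩, hf_isom⟩⟩

theorem exists_eqOn_Ioi [CompleteSpace X] (hL : IsBallLabelling L) {f : ℝ → ι}
    (hf : ∀ δ > 0, ∃ x, EqOn (L x) f (Ici δ)) : ∃ x, EqOn (L x) f (Ioi 0) := by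
  choose x hx using fun n : ℕ => hf (1 / ((n : ℝ) + 1)) Nat.one_div_pos_of_nat
  have hdist : ∀ N n, N ≤ n → dist (x n) (x N) < 1 / ((N : ℝ) + 1) := fun N n hn =>
    (hL _ _ _ Nat.one_div_pos_of_nat).2 fun r (hr : _ ≤ r) =>
      (hx n ((Nat.one_div_le_one_div hn).trans hr)).trans (hx N hr).symm
  have hcauchy : CauchySeq x := Metric.cauchySeq_iff'.2 fun ε hε =>
    let ⟨N, hN⟩ := exists_nat_one_div_lt hε
    ⟨N, fun n hn => (hdist N n hn).trans hN⟩
  obtain ⟨y, hy⟩ := cauchySeq_tendsto_of_complete hcauchy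
  refine ⟨y, fun r (hr : 0 < r) => ?_⟩
  obtain ⟨N, hN⟩ := exists_nat_one_div_lt hr
  obtain ⟨M, hM⟩ := Metric.tendsto_atTop.1 hy r hr
  rw [← (hL _ _ r hr).1 (hM (max N M) (le_max_right _ _)) self_mem_Ici]
  exact hx _ ((Nat.one_div_le_one_div (le_max_left _ _)).trans hN.le)

variable {R : Set ℝ} {L : X → ℝ → ℕ}

theorem exists_eq_indicator (hL : IsBallLabelling L) (hzero : ∃ x, L x = 0)
    (hstep : ∀ x, ∀ r ∈ R, 0 < r → ∀ n, ∃ y, dist x y ≤ r ∧ L y r = n ∧ ∀ s < r, L y s = 0)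
    (f : ℝ → ℕ) (A : Finset ℝ) (hA : (A : Set ℝ) ⊆ R ∩ Ioi 0) :
    ∃ x, L x = (A : Set ℝ).indicator f := by
  classical
  induction A using Finset.induction_on_min with
  | empty => simpa only [Finset.coe_empty, indicator_empty'] using hzero
  | insert a A hmin ih =>
    rw [Finset.coe_insert, insert_subset_iff] at hA
    obtain ⟨x, hx⟩ := ih hA.2
    obtain ⟨y, hxy, hya, hy⟩ := hstep x a hA.1.1 hA.1.2 (f a)
    refine ⟨y, funext fun r => ?_⟩
    rcases lt_trichotomy r a with hr | rfl | hr
    · have hrA : r ∉ A := fun h => (hmin r h).not_gt hr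
      simp [hy r hr, hr.ne, hrA]
    · simp [hya]
    · have hyr : L x r = L y r :=
        (hL x y r (hA.1.2.trans hr)).1 (hxy.trans_lt hr) self_mem_Ici
      simp [← hyr, hx, indicator_apply, hr.ne']

theorem sparseFunctions_subset_range [CompleteSpace X] (hL : IsBallLabelling L)
    (hL0 : ∀ x, ∀ r ≤ 0, L x r = 0) (hzero : ∃ x, L x = 0)
    (hstep : ∀ x, ∀ r ∈ R, 0 < r → ∀ n, ∃ y, dist x y ≤ r ∧ L y r = n ∧ ∀ s < r, L y s = 0) :
    sparseFunctions R ⊆ range L := by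
  rintro f ⟨hfR, hf⟩
  obtain ⟨x, hx⟩ : ∃ x, EqOn (L x) f (Ioi 0) := by
    refine hL.exists_eqOn_Ioi fun δ hδ => ?_
    obtain ⟨x, hx⟩ := hL.exists_eq_indicator hzero hstep f (hf δ hδ).toFinset (by
      rw [Finite.coe_toFinset]
      exact inter_subset_left.trans hfR)
    refine ⟨x, fun r hr => ?_⟩
    rw [hx, Finite.coe_toFinset, indicator_apply_eq_self]
    exact fun h => by_contra fun h0 => h ⟨h0, hr⟩
  refine ⟨x, funext fun r => ?_⟩
  rcases le_or_gt r 0 with hr | hr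
  · rw [hL0 x r hr, Function.notMem_support.1 fun h => hr.not_gt (hfR h).2]
  · exact hx hr

end IsBallLabelling

theorem exists_bijOn_univ_nat_eq_zero {α : Type*} {s : Set α} (hs : s.Countable)
    (hi : s.Infinite) {a : α} (ha : a ∈ s) : ∃ e : α → ℕ, BijOn e s univ ∧ e a = 0 := by
  classical
  obtain ⟨_⟩ := countable_infinite_iff_nonempty_denumerable.1 ⟨hs, hi⟩
  let e := (Denumerable.eqv s).trans (Equiv.swap (Denumerable.eqv s ⟨a, ha⟩) 0)
  let e' : α → ℕ := fun x => if h : x ∈ s then e ⟨x, h⟩ else 0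
  have he : ∀ x (hx : x ∈ s), e' x = e ⟨x, hx⟩ := fun x hx => dif_pos hx
  refine ⟨e', ⟨mapsTo_univ _ _, fun x hx y hy h => ?_, fun n _ => ?_⟩, ?_⟩
  · rw [he x hx, he y hy] at h
    exact congrArg Subtype.val (e.injective h)
  · exact ⟨e.symm n, (e.symm n).2, (he _ (e.symm n).2).trans (e.apply_symm_apply n)⟩
  · exact (he a ha).trans (Equiv.swap_apply_left _ _)

/-- A bijection of `s` onto `ℕ` that maps `a` to `0`; an arbitrary function if there is none. It
is determined by `s` and `a`, so that points in the same closed ball enumerate the open balls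
inside it in the same way. -/
noncomputable def enumerate {α : Type*} (s : Set α) (a : α) : α → ℕ :=
  Classical.epsilon fun e => BijOn e s univ ∧ e a = 0

theorem enumerate_spec {α : Type*} {s : Set α} (hs : s.Countable) (hi : s.Infinite) {a : α}
    (ha : a ∈ s) : BijOn (enumerate s a) s univ ∧ enumerate s a a = 0 :=
  Classical.epsilon_spec (exists_bijOn_univ_nat_eq_zero hs hi ha)

/-- The open balls of radius `r` that make up the closed ball of radius `r` around `x` in an
ultrametric space. -/
def subballs {X : Type*} [MetricSpace X] (x : X) (r : ℝ) : Set (Set X) :=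
  (fun y => Metric.ball y r) '' Metric.closedBall x r

/-- `N x r` says that the open ball of radius `r` around `x` is the selected one among the open
balls of radius `r` in the closed ball of radius `r` around `x`. The last three conditions make the
labelling with label zero for the selected balls take sparse functions as values, and attain all of
them if `X` is complete. -/
structure IsBallSelection {X : Type*} [MetricSpace X] (N : X → ℝ → Prop) : Prop where
  of_dist_lt : ∀ x y r, dist x y < r → N x r → N y r
  dist_lt : ∀ x y r, 0 < r → N x r → N y r → dist x y ≤ r → dist x y < r
  exists_dist_le : ∀ x r, 0 < r → ∃ y, dist x y ≤ r ∧ N y r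
  isFiniteAwayFromZero : ∀ x, IsFiniteAwayFromZero {r | ¬ N x r}
  exists_forall : ∃ x, ∀ r > 0, N x r
  exists_dist_lt : ∀ x r, 0 < r → ∃ y, dist x y < r ∧ ∀ s, 0 < s → s < r → N y s

/-- The open ball of radius `r` selected by `N` in the closed ball of radius `r` around `x`. -/
def selectedBall {X : Type*} [MetricSpace X] (N : X → ℝ → Prop) (x : X) (r : ℝ) : Set X :=
  {y ∈ Metric.closedBall x r | N y r}

open scoped Classical in
/-- The coordinates of a point `x`: the label at a positive `r ∈ R` is the number of the ball of
radius `r` around `x` in an enumeration, which starts with the selected ball, of the open balls of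
radius `r` in the closed one. -/
noncomputable def ballLabel {X : Type*} [MetricSpace X] (R : Set ℝ) (N : X → ℝ → Prop) (x : X)
    (r : ℝ) : ℕ :=
  if r ∈ R ∧ 0 < r then enumerate (subballs x r) (selectedBall N x r) (Metric.ball x r) else 0

section BallLabel

variable {X : Type*} [MetricSpace X] {R : Set ℝ} {N : X → ℝ → Prop} {x y : X} {r : ℝ}

theorem dist_lt_of_ball_eq (hr : 0 < r) (h : Metric.ball x r = Metric.ball y r) : dist x y < r :=
  Metric.mem_ball.1 (h ▸ Metric.mem_ball_self hr)

theorem ball_mem_subballs (h : dist y x ≤ r) : Metric.ball y r ∈ subballs x r :=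
  mem_image_of_mem _ h

theorem mem_selectedBall_self (hr : 0 < r) : x ∈ selectedBall N x r ↔ N x r :=
  and_iff_right (Metric.mem_closedBall_self hr.le)

theorem ballLabel_of_pos (hr : r ∈ R) (hr0 : 0 < r) : ballLabel R N x r =
    enumerate (subballs x r) (selectedBall N x r) (Metric.ball x r) :=
  if_pos ⟨hr, hr0⟩

theorem support_ballLabel_subset (x : X) : Function.support (ballLabel R N x) ⊆ R ∩ Ioi 0 :=
  fun _ hr => by_contra fun h => hr (if_neg h)

variable [IsUltrametricDist X]

theorem subballs_eq_of_dist_le (h : dist x y ≤ r) : subballs x r = subballs y r := by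
  rw [subballs, ← IsUltrametricDist.closedBall_eq_of_mem h, subballs]

theorem selectedBall_eq_of_dist_le (h : dist x y ≤ r) :
    selectedBall N x r = selectedBall N y r := by
  rw [selectedBall, ← IsUltrametricDist.closedBall_eq_of_mem h, selectedBall]

theorem ballLabel_eq_of_dist_lt (h : dist x y < r) : ballLabel R N x r = ballLabel R N y r := by
  rw [ballLabel, subballs_eq_of_dist_le h.le, selectedBall_eq_of_dist_le h.le,
    ← IsUltrametricDist.ball_eq_of_mem h, ballLabel]

theorem HasEquidistantExtension.infinite_subballs (hX : HasEquidistantExtension R X) (x : X)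
    (hr : r ∈ R) (hr0 : 0 < r) : (subballs x r).Infinite := by
  intro hfin
  obtain ⟨A, hA, hbij⟩ := exists_subset_bijOn (Metric.closedBall x r) fun y => Metric.ball y r
  have hle : ∀ y ∈ insert x A, dist y x ≤ r :=
    forall_mem_insert.2 ⟨(dist_self x).trans_le hr0.le, fun y hy => hA hy⟩
  obtain ⟨p, hp⟩ := hX r hr hr0 (insert x A) ((hbij.finite_iff_finite.2 hfin).insert x)
    fun y hy z hz => (dist_triangle_max y x z).trans (max_le (hle y hy) (dist_comm z x ▸ hle z hz))
  obtain ⟨a, ha, hpa⟩ := hbij.surjOn (ball_mem_subballs (hp x (mem_insert x A)).le)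
  exact (dist_lt_of_ball_eq hr0 hpa.symm).ne (hp a (mem_insert_of_mem x ha))

namespace IsBallSelection

theorem selectedBall_mem_subballs (hN : IsBallSelection N) (x : X) (hr : 0 < r) :
    selectedBall N x r ∈ subballs x r := by
  obtain ⟨c, hxc, hc⟩ := hN.exists_dist_le x r hr
  have hcx : dist c x ≤ r := dist_comm x c ▸ hxc
  refine ⟨c, hcx, Subset.antisymm (fun y (hy : dist y c < r) => ?_) ?_⟩
  · exact ⟨(dist_triangle_max y c x).trans (max_le hy.le hcx),
      hN.of_dist_lt c y r (dist_comm y c ▸ hy) hc⟩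
  · rintro y ⟨hyx, hy⟩
    exact hN.dist_lt y c r hr hy hc ((dist_triangle_max y x c).trans (max_le hyx hxc))

theorem ball_eq_selectedBall_iff (hN : IsBallSelection N) (hr : 0 < r) :
    Metric.ball x r = selectedBall N x r ↔ N x r := by
  obtain ⟨c, -, hc⟩ := hN.selectedBall_mem_subballs x hr
  rw [← mem_selectedBall_self (N := N) hr, ← hc]
  exact ⟨fun h => h ▸ Metric.mem_ball_self hr,
    fun h => (IsUltrametricDist.ball_eq_of_mem h).symm⟩

theorem enumerate_subballs_spec (hN : IsBallSelection N) (hX : HasEquidistantExtension R X)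
    (hc : (subballs x r).Countable) (hr : r ∈ R) (hr0 : 0 < r) :
    BijOn (enumerate (subballs x r) (selectedBall N x r)) (subballs x r) univ ∧
      enumerate (subballs x r) (selectedBall N x r) (selectedBall N x r) = 0 :=
  enumerate_spec hc (hX.infinite_subballs x hr hr0) (hN.selectedBall_mem_subballs x hr0)

theorem ballLabel_eq_zero_iff (hN : IsBallSelection N) (hX : HasEquidistantExtension R X)
    (hc : (subballs x r).Countable) (hr : r ∈ R) (hr0 : 0 < r) :
    ballLabel R N x r = 0 ↔ N x r := by
  obtain ⟨hbij, hzero⟩ := hN.enumerate_subballs_spec hX hc hr hr0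
  rw [ballLabel_of_pos hr hr0, ← hN.ball_eq_selectedBall_iff hr0, ← hzero,
    hbij.injOn.eq_iff (ball_mem_subballs ((dist_self x).trans_le hr0.le))
      (hN.selectedBall_mem_subballs x hr0)]

theorem ballLabel_eq_zero (hN : IsBallSelection N) (hX : HasEquidistantExtension R X)
    (hc : ∀ r ∈ R, 0 < r → (subballs x r).Countable) (h : 0 < r → N x r) :
    ballLabel R N x r = 0 := by
  by_cases hr : r ∈ R ∧ 0 < r
  · exact (hN.ballLabel_eq_zero_iff hX (hc r hr.1 hr.2) hr.1 hr.2).2 (h hr.2)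
  · exact if_neg hr

theorem exists_ballLabel_eq (hN : IsBallSelection N) (hX : HasEquidistantExtension R X)
    (hc : (subballs x r).Countable) (hr : r ∈ R) (hr0 : 0 < r) (n : ℕ) :
    ∃ y, dist x y ≤ r ∧ ballLabel R N y r = n := by
  obtain ⟨_, ⟨y, hyx, rfl⟩, hn⟩ :=
    (hN.enumerate_subballs_spec hX hc hr hr0).1.surjOn (mem_univ n)
  have hxy : dist x y ≤ r := dist_comm y x ▸ hyx
  refine ⟨y, hxy, ?_⟩
  rwa [ballLabel_of_pos hr hr0, ← subballs_eq_of_dist_le hxy, ← selectedBall_eq_of_dist_le hxy]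

theorem ballLabel_dist_ne (hN : IsBallSelection N) (hX : HasEquidistantExtension R X)
    (hc : (subballs x (dist x y)).Countable) (hr : dist x y ∈ R) (hr0 : 0 < dist x y) :
    ballLabel R N x (dist x y) ≠ ballLabel R N y (dist x y) := by
  intro h
  rw [ballLabel_of_pos hr hr0, ballLabel_of_pos hr hr0, ← subballs_eq_of_dist_le le_rfl,
    ← selectedBall_eq_of_dist_le le_rfl] at h
  have hball := (hN.enumerate_subballs_spec hX hc hr hr0).1.injOn
    (ball_mem_subballs ((dist_self x).trans_le hr0.le)) (ball_mem_subballs (dist_comm y x).le) h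
  exact (dist_lt_of_ball_eq hr0 hball).ne rfl

theorem isBallLabelling_ballLabel (hN : IsBallSelection N) (hX : HasEquidistantExtension R X)
    (hv : IsValuedUltrametric R X) (hc : ∀ x : X, ∀ r ∈ R, 0 < r → (subballs x r).Countable) :
    IsBallLabelling (ballLabel R N) := by
  refine fun x y r hr => ⟨fun h s hs => ballLabel_eq_of_dist_lt (h.trans_le hs), fun h => ?_⟩
  by_contra! hle
  have hxy := hr.trans_le hle
  have hR := hv.dist_mem x y
  exact hN.ballLabel_dist_ne hX (hc x _ hR hxy) hR hxy (h hle)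

theorem range_ballLabel [CompleteSpace X] (hN : IsBallSelection N)
    (hX : HasEquidistantExtension R X) (hv : IsValuedUltrametric R X)
    (hc : ∀ x : X, ∀ r ∈ R, 0 < r → (subballs x r).Countable) :
    range (ballLabel R N) = sparseFunctions R := by
  refine Subset.antisymm (range_subset_iff.2 fun x => ⟨support_ballLabel_subset x, ?_⟩) ?_
  · exact (hN.isFiniteAwayFromZero x).mono fun r hr h =>
      hr (hN.ballLabel_eq_zero hX (hc x) fun _ => h)
  refine (hN.isBallLabelling_ballLabel hX hv hc).sparseFunctions_subset_range
    (fun x r hr => if_neg fun h => hr.not_gt h.2) ?_ fun x r hr hr0 n => ?_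
  · obtain ⟨x, hx⟩ := hN.exists_forall
    exact ⟨x, funext fun r => hN.ballLabel_eq_zero hX (hc x) (hx r)⟩
  · obtain ⟨y, hxy, hy⟩ := hN.exists_ballLabel_eq hX (hc x r hr hr0) hr hr0 n
    obtain ⟨z, hyz, hz⟩ := hN.exists_dist_lt y r hr0
    refine ⟨z, (dist_triangle_max x y z).trans (max_le hxy hyz.le),
      (ballLabel_eq_of_dist_lt hyz).symm.trans hy, fun s hs => ?_⟩
    exact hN.ballLabel_eq_zero hX (hc z) fun hs0 => hz s hs0 hs

end IsBallSelection
end BallLabel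

section Uniqueness

variable {X Y : Type*} [MetricSpace X] [MetricSpace Y] {R : Set ℝ}

theorem countable_subballs_of_forall_exists [IsUltrametricDist X] {D : Set X} (hD : D.Countable)
    {x : X} {r : ℝ} (h : ∀ y, dist y x ≤ r → ∃ z ∈ D, dist y z < r) : (subballs x r).Countable := by
  refine (hD.image fun z => Metric.ball z r).mono (image_subset_iff.2 fun y hy => ?_)
  obtain ⟨z, hz, hyz⟩ := h y hy
  exact ⟨z, hz, IsUltrametricDist.ball_eq_of_mem hyz⟩

/-- The selected ball is the one that contains the first member of the sequence that lies in the
closed ball. -/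
theorem isBallSelection_of_denseRange [IsUltrametricDist X] {u : ℕ → X} (hu : DenseRange u) :
    IsBallSelection fun x r => ∃ n, dist x (u n) < r ∧ ∀ i < n, r < dist x (u i) where
  of_dist_lt x y r hxy := by
    rintro ⟨n, hn, hmin⟩
    rw [dist_comm] at hxy
    refine ⟨n, (dist_triangle_max y x _).trans_lt (max_lt hxy hn), fun i hi => ?_⟩
    rw [dist_eq_of_dist_lt (hxy.trans (hmin i hi))]
    exact hmin i hi
  dist_lt x y r _ := by
    rintro ⟨n, hn, hnmin⟩ ⟨k, hk, hkmin⟩ hxy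
    obtain rfl : n = k := by
      refine le_antisymm (le_of_not_gt fun h => (hnmin k h).not_ge ?_)
        (le_of_not_gt fun h => (hkmin n h).not_ge ?_)
      · exact (dist_triangle_max x y _).trans (max_le hxy hk.le)
      · exact (dist_triangle_max y x _).trans (max_le (dist_comm x y ▸ hxy) hn.le)
    exact (dist_triangle_max x (u n) y).trans_lt (max_lt hn (dist_comm y (u n) ▸ hk))
  exists_dist_le x r hr := by
    classical
    obtain ⟨n, hn, hmin⟩ := Nat.findX ((hu.exists_dist_lt x hr).imp fun _ h => h.le)
    refine ⟨u n, hn, n, (dist_self (u n)).trans_lt hr, fun i hi => ?_⟩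
    have hri := not_le.1 (hmin i hi)
    rwa [dist_eq_of_dist_lt ((dist_comm (u n) x ▸ hn).trans_lt hri)]
  isFiniteAwayFromZero x δ hδ := by
    classical
    obtain ⟨n, hn⟩ := hu.exists_dist_lt x hδ
    refine ((finite_Iic n).image fun i => dist x (u i)).subset ?_
    rintro r ⟨hr, hδr⟩
    have hnr : dist x (u n) ≤ r := hn.le.trans hδr
    obtain ⟨k, hk, hmin⟩ := Nat.findX (p := fun k => dist x (u k) ≤ r) ⟨n, hnr⟩
    refine ⟨k, le_of_not_gt fun h => hmin n h hnr, hk.antisymm (le_of_not_gt fun h => ?_)⟩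
    exact hr ⟨k, h, fun i hi => not_le.1 (hmin i hi)⟩
  exists_forall := ⟨u 0, fun r hr =>
    ⟨0, (dist_self (u 0)).trans_lt hr, fun i hi => absurd hi i.not_lt_zero⟩⟩
  exists_dist_lt x r hr := by
    classical
    obtain ⟨n, hn, hmin⟩ := Nat.findX (hu.exists_dist_lt x hr)
    refine ⟨u n, hn, fun s hs hsr => ⟨n, (dist_self (u n)).trans_lt hs, fun i hi => ?_⟩⟩
    have hri := not_lt.1 (hmin i hi)
    rw [dist_eq_of_dist_lt ((dist_comm (u n) x ▸ hn).trans_le hri)]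
    exact hsr.trans_le hri

theorem IsSeparableUrysohnUltrametric.exists_isBallLabelling (h0 : 0 ∈ R)
    (hX : IsSeparableUrysohnUltrametric R X) :
    ∃ L : X → ℝ → ℕ, IsBallLabelling L ∧ range L = sparseFunctions R := by
  have := hX.valued.ultra
  have := hX.complete
  have := hX.separable
  have := hX.injective.1
  have hu := denseRange_denseSeq X
  have hN := isBallSelection_of_denseRange hu
  have hE := hX.injective.hasEquidistantExtension h0 hX.valued
  have hc : ∀ x : X, ∀ r ∈ R, 0 < r → (subballs x r).Countable := fun x r _ hr =>
    countable_subballs_of_forall_exists (countable_range (denseSeq X)) fun y _ =>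
      exists_range_iff.2 (hu.exists_dist_lt y hr)
  exact ⟨_, hN.isBallLabelling_ballLabel hE hX.valued hc, hN.range_ballLabel hE hX.valued hc⟩

namespace IsPetal

variable [IsUltrametricDist X] {P : Set ℝ → Set X}

theorem isBallSelection (hP : IsPetal R X P) (hR : IsRangeSet R) (hc : ¬ R.Countable) :
    IsBallSelection fun x r =>
      ∃ S ∈ tenuousRangeSubsets R, r ∉ S ∧ ∃ y ∈ P S, dist x y < r where
  of_dist_lt x y r hxy := by
    rintro ⟨S, hS, hrS, z, hz, hxz⟩
    exact ⟨S, hS, hrS, z, hz,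
      (dist_triangle_max y x z).trans_lt (max_lt (dist_comm x y ▸ hxy) hxz)⟩
  dist_lt x y r _ := by
    rintro ⟨S, hS, hrS, a, ha, hxa⟩ ⟨T, hT, hrT, b, hb, hyb⟩ hxy
    refine hxy.lt_of_ne fun h => ?_
    have hay : dist a y = dist x y := dist_eq_of_dist_lt (by rwa [dist_comm, h])
    have hba : dist b a = dist y a :=
      dist_eq_of_dist_lt (by rwa [dist_comm b y, dist_comm y a, hay, h])
    have hab : dist a b = r := by rw [dist_comm, hba, dist_comm, hay, h]
    exact (hab ▸ hP.dist_mem_union hR hc hS hT ha hb).elim hrS hrT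
  exists_dist_le x r hr := by
    obtain ⟨T, hT, hx⟩ := hP.exists_mem x
    have hS := mem_tenuousRangeSubsets_of_subset hR hT (sdiff_subset : T \ {r} ⊆ T)
      ⟨hT.1.2, hr.ne⟩
    obtain ⟨y, hy, hxy⟩ := hP.exists_dist_le hR hc hS hT hx hr
      fun s hs => (by_contra fun h => hs.2 ⟨hs.1, h⟩ : s = r).le
    exact ⟨y, hxy, _, hS, fun h => h.2 rfl, y, hy, (dist_self y).trans_lt hr⟩
  isFiniteAwayFromZero x := by
    obtain ⟨T, hT, hx⟩ := hP.exists_mem x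
    refine fun δ hδ => (((mem_tenuousRangeSubsets hR).1 hT).2.1 δ hδ).subset ?_
    rintro r ⟨hr, hδr⟩
    exact ⟨by_contra fun hrT => hr ⟨T, hT, hrT, x, hx, (dist_self x).trans_lt (hδ.trans_le hδr)⟩,
      hδr⟩
  exists_forall := by
    have hS := singleton_zero_mem_tenuousRangeSubsets hR
    obtain ⟨x, hx⟩ := hP.nonempty _ hS
    exact ⟨x, fun r hr => ⟨_, hS, hr.ne', x, hx, (dist_self x).trans_lt hr⟩⟩
  exists_dist_lt x r hr := by
    obtain ⟨T, hT, hx⟩ := hP.exists_mem x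
    have hS := mem_tenuousRangeSubsets_of_subset hR hT
      (insert_subset hT.1.2 inter_subset_left : insert 0 (T ∩ Ici r) ⊆ T) (mem_insert _ _)
    obtain ⟨y, hy, hxy⟩ := hP.exists_dist_lt hS hT hx hr
      fun s hs => mem_Iio.2 (lt_of_not_ge fun h => hs.2 (Or.inr ⟨hs.1, h⟩))
    refine ⟨y, hxy, fun s hs hsr => ⟨_, hS, ?_, y, hy, (dist_self y).trans_lt hs⟩⟩
    rintro (h | h)
    · exact hs.ne' h
    · exact hsr.not_ge h.2

theorem countable_subballs (hP : IsPetal R X P) (hR : IsRangeSet R) (x : X) {r : ℝ} (hr : r ∈ R)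
    (hr0 : 0 < r) : (subballs x r).Countable := by
  obtain ⟨T, hT, hx⟩ := hP.exists_mem x
  have hS := insert_mem_tenuousRangeSubsets hR hT hr
  have := (hP.urysohn _ hS (ne_singleton_zero_of_mem (mem_insert r T) hr0)).separable
  obtain ⟨D, hD, hPD⟩ := IsSeparable.of_subtype (P (insert r T))
  refine countable_subballs_of_forall_exists hD fun y hyx => ?_
  obtain ⟨T', hT', hy⟩ := hP.exists_mem y
  have hle : Metric.infDist y (P (insert r T)) ≤ r :=
    (Metric.infDist_le_dist_of_mem (hP.mono hT hS (subset_insert r T) hx)).trans hyx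
  have hne : Metric.infDist y (P (insert r T)) ≠ r := by
    intro h
    have hmem := hP.infDist_mem _ hS _ hT' y hy
    rw [h] at hmem
    exact hmem.elim hr0.ne' fun hr' => hr'.2 (mem_insert r T)
  obtain ⟨z, hz, hyz⟩ := (Metric.infDist_lt_iff (hP.nonempty _ hS)).1 (hle.lt_of_ne hne)
  obtain ⟨w, hw, hzw⟩ := Metric.mem_closure_iff.1 (hPD hz) r hr0
  exact ⟨w, hw, (dist_triangle_max y z w).trans_lt (max_lt hyz hzw)⟩

end IsPetal

theorem IsPetaloid.exists_isBallLabelling (hR : IsRangeSet R) (hc : ¬ R.Countable)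
    (hX : IsPetaloid R X) :
    ∃ L : X → ℝ → ℕ, IsBallLabelling L ∧ range L = sparseFunctions R := by
  obtain ⟨hv, P, hP⟩ := hX
  have := hv.ultra
  have := hP.completeSpace hR hc
  have hN := hP.isBallSelection hR hc
  have hE := hP.hasEquidistantExtension hR hc
  have hcb : ∀ x : X, ∀ r ∈ R, 0 < r → (subballs x r).Countable := fun x _ =>
    hP.countable_subballs hR x
  exact ⟨_, hN.isBallLabelling_ballLabel hE hv hcb, hN.range_ballLabel hE hv hcb⟩

namespace IsUrysohnUniversalUltrametric

theorem exists_isBallLabelling (hR : IsRangeSet R) (hX : IsUrysohnUniversalUltrametric R X) :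
    ∃ L : X → ℝ → ℕ, IsBallLabelling L ∧ range L = sparseFunctions R := by
  by_cases hc : R.Countable
  · exact (hX.1 hc).exists_isBallLabelling hR.2
  · exact (hX.2 hc).exists_isBallLabelling hR hc

theorem nonempty_isometryEquiv (hR : IsRangeSet R) (hX : IsUrysohnUniversalUltrametric R X)
    (hY : IsUrysohnUniversalUltrametric R Y) : Nonempty (X ≃ᵢ Y) := by
  obtain ⟨L, hL, hLR⟩ := hX.exists_isBallLabelling hR
  obtain ⟨M, hM, hMR⟩ := hY.exists_isBallLabelling hR
  exact hL.nonempty_isometryEquiv hM (hLR.trans hMR.symm)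

theorem boundedHyperspace (hR : IsRangeSet R) (hX : IsUrysohnUniversalUltrametric R X) {m : ℕ∞}
    {l : ℝ≥0∞} (hm : 1 ≤ m) : IsUrysohnUniversalUltrametric R (BoundedHyperspace X m l) := by
  refine ⟨fun hc => (hX.1 hc).boundedHyperspace hR.2 hm, fun hc => ?_⟩
  obtain ⟨hv, P, hP⟩ := hX.2 hc
  have := hv.ultra
  exact ⟨hv.boundedHyperspace, _, hP.boundedHyperspace hR hc hm⟩

end IsUrysohnUniversalUltrametric

end Uniqueness

theorem mainTheorem4 {X : Type*} [MetricSpace X] (R : Set ℝ) (hR : IsRangeSet R)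
    (m : ℕ∞) (hm : 2 ≤ m) (l : ℝ≥0∞) (hl : 0 < l)
    (hX : IsUrysohnUniversalUltrametric R X) :
    IsUrysohnUniversalUltrametric R (BoundedHyperspace X m l) ∧
      Nonempty (BoundedHyperspace X m l ≃ᵢ X) :=
  have hK := hX.boundedHyperspace hR (one_le_two.trans hm)
  ⟨hK, hK.nonempty_isometryEquiv hR hX⟩
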